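/- Let $\alpha=(\alpha_n)_{n\ge 0}$ be a non-negative, (weakly) increasing real sequence with $\lim_{n\to\infty}\alpha_n=\infty$, $\lim_{n\to\infty}(\alpha_{n+1}-\alpha_n)=0$, and $\alpha_n\ge c\log(n+1)$ for all $n\ge 0$ and some constant $c>0$. Let $$\Lambda_\infty(\alpha)=\Big\{x\in\mathbb C^{\mathbb N_0} : |x|_k^2:=\sum_{n=0}^\infty |x_n|^2e^{2k\alpha_n}<\infty \text{ for all } k=1,2,\dots\Big\},$$ with the locally convex topology generated by the norms $|\cdot|_k$. Let $r,s\in\mathbb R\setminus\{0\}$ and let $B=B(r,s)$ be the continuous linear operator on $\Lambda_\infty(\alpha)$ given by $(Bx)_n=s\,x_{n-1}+r\,x_n$ for $n\ge 0$, where $x_{-1}:=0$. Write $\mathcal L(X)$ for the space of continuous linear operators on $X=\Lambda_\infty(\alpha)$; $\mathcal L_s(X)$ and $\mathcal L_b(X)$ denote it with the topology of pointwise convergence and of uniform convergence on bounded sets, respectively. For $T\in\mathcal L(X)$ put $T_{[n]}=\frac1n\sum_{m=1}^nT^m$. The operator $T$ is mean ergodic (uniformly mean ergodic) if $(T_{[n]})_{n\ge1}$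 converges in $\mathcal L_s(X)$ (in $\mathcal L_b(X)$); it is power bounded if $\{T^n:n\ge 0\}$ is equicontinuous; it is supercyclic if $\{\lambda T^nx:n\ge 0,\ \lambda\in\mathbb C\}$ is dense in $X$ for some $x\in X$. The spectrum $\sigma(T,X)$ is the set of $\lambda\in\mathbb C$ such that $T-\lambda I$ has no inverse in $\mathcal L(X)$. (a) Consider the statements (1) $B$ is mean ergodic; (2) $B^n/n\to0$ in $\mathcal L_s(\Lambda_\infty(\alpha))$ as $n\to\infty$; (3) $|r|+|s|\le 1$. Then $(1)\Rightarrow(2)\Rightarrow(3)$. (b) Consider the statements (1) $|r|+|s|<1$; (2) $B^n\to0$ in $\mathcal L_b(\Lambda_\infty(\alpha))$ as $n\to\infty$; (3) $B$ is power bounded; (4) $B$ is uniformly mean ergodic; (5) $1\notin\sigma(B,\Lambda_\infty(\alpha))$. Then $(1)\Rightarrow(2)\Rightarrow(3)\Rightarrow(4)\Rightarrow(5)$. (c) $B$ is not supercyclic. -/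

import Mathlib

open Filter Topology

noncomputable section

/-! ## Ergodic and dynamical notions for operators on topological vector spaces -/

namespace ErgodicOp

variable {X : Type*} [AddCommGroup X] [Module ℂ X] [TopologicalSpace X]
  [IsTopologicalAddGroup X] [ContinuousSMul ℂ X]

/-- The Cesàro means `T_[n] = (1/n) ∑_{m=1}^n T^m` (only the values for `n ≥ 1` matter). -/
def cesaroMean (T : X →L[ℂ] X) (n : ℕ) : X →L[ℂ] X :=
  (n : ℂ)⁻¹ • ∑ m ∈ Finset.Icc 1 n, T ^ m

/-- Convergence in `ℒ_s(X)`: pointwise convergence on `X`. -/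
def TendstoStrong (T : ℕ → X →L[ℂ] X) (P : X →L[ℂ] X) : Prop :=
  ∀ x : X, Tendsto (fun n => T n x) atTop (𝓝 (P x))

/-- Convergence in `ℒ_b(X)`: convergence for Mathlib's topology on `X →L[ℂ] X`, which is the
topology of uniform convergence on the (von Neumann) bounded subsets of `X`. -/
def TendstoUniform (T : ℕ → X →L[ℂ] X) (P : X →L[ℂ] X) : Prop :=
  Tendsto T atTop (𝓝 P)

/-- `T` is mean ergodic: its Cesàro means converge in `ℒ_s(X)`. -/
def MeanErgodic (T : X →L[ℂ] X) : Prop :=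
  ∃ P : X →L[ℂ] X, TendstoStrong (cesaroMean T) P

/-- `T` is uniformly mean ergodic: its Cesàro means converge in `ℒ_b(X)`. -/
def UniformlyMeanErgodic (T : X →L[ℂ] X) : Prop :=
  ∃ P : X →L[ℂ] X, TendstoUniform (cesaroMean T) P

/-- `T` is power bounded: `{T^n : n ∈ ℕ₀}` is an equicontinuous set of linear operators, i.e. every
neighbourhood `U` of `0` admits one neighbourhood `V` of `0` with `T^n(V) ⊆ U` for all `n`. -/
def PowerBounded (T : X →L[ℂ] X) : Prop :=
  ∀ U ∈ 𝓝 (0 : X), ∃ V ∈ 𝓝 (0 : X), ∀ n : ℕ, Set.MapsTo (T ^ n : X →L[ℂ] X) V U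

/-- `T` is supercyclic: some projective orbit `{λ T^n x : n ∈ ℕ₀, λ ∈ ℂ}` is dense in `X`. -/
def Supercyclic (T : X →L[ℂ] X) : Prop :=
  ∃ x : X, Dense {y : X | ∃ (n : ℕ) (c : ℂ), y = c • (T ^ n) x}

end ErgodicOp

/-! ## Power series spaces of infinite type -/

/-- The terms `|x_n|² e^{2kα_n}` of the series defining `|x|_k²`. -/
def PowerSeriesSpace.term (α : ℕ → ℝ) (k : ℕ+) (x : ℕ → ℂ) (n : ℕ) : ℝ :=
  ‖x n‖ ^ 2 * Real.exp (2 * (k : ℕ) * α n)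

theorem PowerSeriesSpace.term_nonneg (α : ℕ → ℝ) (k : ℕ+) (x : ℕ → ℂ) (n : ℕ) :
    0 ≤ term α k x n := by
  unfold term; positivity

/-- `‖a + b‖² ≤ 2‖a‖² + 2‖b‖²`. -/
theorem PowerSeriesSpace.norm_add_sq_le (a b : ℂ) :
    ‖a + b‖ ^ 2 ≤ 2 * ‖a‖ ^ 2 + 2 * ‖b‖ ^ 2 := by
  have h := norm_add_le a b
  nlinarith [norm_nonneg (a + b), sq_nonneg (‖a‖ - ‖b‖), norm_nonneg a, norm_nonneg b]

/-- The sequences `x` with `∑ |x_n|² e^{2kα_n} < ∞` for all `k = 1, 2, …`, as a subspace of the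
space of all complex sequences. -/
def powerSeriesSubmodule (α : ℕ → ℝ) : Submodule ℂ (ℕ → ℂ) where
  carrier := {x | ∀ k : ℕ+, Summable (PowerSeriesSpace.term α k x)}
  zero_mem' k := by
    have : PowerSeriesSpace.term α k 0 = 0 := by
      funext n; simp [PowerSeriesSpace.term]
    rw [this]; exact summable_zero
  add_mem' {x y} hx hy k := by
    refine Summable.of_nonneg_of_le (PowerSeriesSpace.term_nonneg α k _) (fun n => ?_)
      (((hx k).mul_left 2).add ((hy k).mul_left 2))
    have h := PowerSeriesSpace.norm_add_sq_le (x n) (y n)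
    have := mul_le_mul_of_nonneg_right h (Real.exp_pos (2 * (k : ℕ) * α n)).le
    simp only [PowerSeriesSpace.term, Pi.add_apply]
    linarith
  smul_mem' c x hx k := by
    have : PowerSeriesSpace.term α k (c • x) =
        fun n => ‖c‖ ^ 2 * PowerSeriesSpace.term α k x n := by
      funext n; simp [PowerSeriesSpace.term, mul_pow, mul_assoc]
    rw [this]; exact (hx k).mul_left _

/-- The power series space `Λ_∞(α)` of infinite type. It is a type of its own (rather than a
coerced subspace), since it does not carry the topology of coordinatewise convergence. -/
def PowerSeriesSpace (α : ℕ → ℝ) : Type := powerSeriesSubmodule α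

namespace PowerSeriesSpace

variable {α : ℕ → ℝ}

instance : AddCommGroup (PowerSeriesSpace α) := inferInstanceAs (AddCommGroup (powerSeriesSubmodule α))

instance : Module ℂ (PowerSeriesSpace α) := inferInstanceAs (Module ℂ (powerSeriesSubmodule α))

/-- The inclusion of `Λ_∞(α)` in the space of all sequences. -/
def toSeq (α : ℕ → ℝ) : PowerSeriesSpace α →ₗ[ℂ] (ℕ → ℂ) := (powerSeriesSubmodule α).subtype

theorem summable_term (k : ℕ+) (x : PowerSeriesSpace α) : Summable (term α k (toSeq α x)) :=
  x.2 k

/-- The norm `|x|_k = (∑ |x_n|² e^{2kα_n})^{1/2}` on `Λ_∞(α)`. -/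
def seminorm (α : ℕ → ℝ) (k : ℕ+) : Seminorm ℂ (PowerSeriesSpace α) :=
  Seminorm.of (fun x => √(∑' n, term α k (toSeq α x) n))
    (fun x y => by
      have key : ∀ (z : PowerSeriesSpace α) n, term α k (toSeq α z) n =
          (‖toSeq α z n‖ * Real.exp ((k : ℕ) * α n)) ^ (2 : ℝ) := by
        intro z n
        rw [Real.rpow_two, mul_pow, ← Real.exp_nat_mul, term]
        congr 2; push_cast; ring
      have hf : ∀ (z : PowerSeriesSpace α) n,
          0 ≤ ‖toSeq α z n‖ * Real.exp ((k : ℕ) * α n) := fun z n => by positivity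
      have hs : ∀ z : PowerSeriesSpace α, Summable fun n =>
          (‖toSeq α z n‖ * Real.exp ((k : ℕ) * α n)) ^ (2 : ℝ) := fun z => by
        simpa only [← key] using summable_term k z
      obtain ⟨h1, h2⟩ := Real.Lp_add_le_tsum_of_nonneg (p := 2) one_le_two (hf x) (hf y) (hs x) (hs y)
      simp only [key, Real.sqrt_eq_rpow]
      refine le_trans (Real.rpow_le_rpow (tsum_nonneg fun n => Real.rpow_nonneg (hf _ n) _) ?_
        (by norm_num)) h2
      refine Summable.tsum_le_tsum (fun n => Real.rpow_le_rpow (hf _ n) ?_ (by norm_num)) (hs _) h1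
      rw [← add_mul, map_add]
      exact mul_le_mul_of_nonneg_right (norm_add_le _ _) (Real.exp_pos _).le)
    (fun c x => by
      have : term α k (toSeq α (c • x)) = fun n => ‖c‖ ^ 2 * term α k (toSeq α x) n := by
        funext n; simp [term, mul_pow, mul_assoc]
      rw [this, tsum_mul_left, Real.sqrt_mul (by positivity), Real.sqrt_sq (norm_nonneg c)])

theorem seminorm_apply (k : ℕ+) (x : PowerSeriesSpace α) :
    seminorm α k x = √(∑' n, ‖toSeq α x n‖ ^ 2 * Real.exp (2 * (k : ℕ) * α n)) := rfl

/-- The family of norms `(|·|_k)`, `k = 1, 2, …`. -/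
def seminorms (α : ℕ → ℝ) : SeminormFamily ℂ (PowerSeriesSpace α) ℕ+ := seminorm α

/-- `Λ_∞(α)` carries the locally convex topology generated by the norms `|·|_k`. -/
instance : TopologicalSpace (PowerSeriesSpace α) := (seminorms α).moduleFilterBasis.topology

theorem withSeminorms (α : ℕ → ℝ) : WithSeminorms (seminorms α) := ⟨rfl⟩

instance : IsTopologicalAddGroup (PowerSeriesSpace α) := (withSeminorms α).topologicalAddGroup

instance : ContinuousSMul ℂ (PowerSeriesSpace α) := (withSeminorms α).continuousSMul

end PowerSeriesSpace

/-! ## The generalized difference operator -/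

/-- `B(r,s)` on the space of all complex sequences: `(B(r,s)x)_n = s x_{n-1} + r x_n`, with
`x_{-1} = 0`. -/
def genDiffSeq (r s : ℝ) : (ℕ → ℂ) →ₗ[ℂ] (ℕ → ℂ) where
  toFun x n := (s : ℂ) * (if n = 0 then 0 else x (n - 1)) + (r : ℂ) * x n
  map_add' x y := by
    funext n
    rcases n with _ | n <;> simp <;> ring
  map_smul' c x := by
    funext n
    rcases n with _ | n <;> simp <;> ring

/-- If `α_{n+1} - α_n ≤ M`, then `|B(r,s)x|_k² ≤ C |x|_k²` with `C = 2s²e^{2kM} + 2r²`. -/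
theorem genDiffSeq_summable_and_tsum_le {α : ℕ → ℝ} {M : ℝ} (hM : ∀ n, α (n + 1) - α n ≤ M)
    (r s : ℝ) (k : ℕ+) (x : ℕ → ℂ) (hx : Summable (PowerSeriesSpace.term α k x)) :
    Summable (PowerSeriesSpace.term α k (genDiffSeq r s x)) ∧
      ∑' n, PowerSeriesSpace.term α k (genDiffSeq r s x) n ≤
        (2 * s ^ 2 * Real.exp (2 * (k : ℕ) * M) + 2 * r ^ 2) *
          ∑' n, PowerSeriesSpace.term α k x n := by
  set E := Real.exp (2 * (k : ℕ) * M)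
  set a : ℕ → ℝ := PowerSeriesSpace.term α k x
  let b : ℕ → ℝ := fun n => if n = 0 then 0 else a (n - 1)
  have hb : HasSum b (∑' n, a n) := by
    have h : HasSum (fun n => b (n + 1)) (∑' n, a n) := by simpa [b] using hx.hasSum
    simpa [b] using (hasSum_nat_add_iff' (f := b) 1).1 (by simpa [b] using h)
  have hle : ∀ n, PowerSeriesSpace.term α k (genDiffSeq r s x) n ≤
      2 * s ^ 2 * E * b n + 2 * r ^ 2 * a n := by
    intro n
    have h := mul_le_mul_of_nonneg_right (PowerSeriesSpace.norm_add_sq_le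
      ((s : ℂ) * (if n = 0 then 0 else x (n - 1))) ((r : ℂ) * x n))
      (Real.exp_pos (2 * (k : ℕ) * α n)).le
    refine h.trans ?_
    rw [add_mul]
    refine add_le_add ?_ (le_of_eq ?_)
    · rcases n with _ | n
      · simp [b]
      · have he : Real.exp (2 * (k : ℕ) * α (n + 1)) ≤ E * Real.exp (2 * (k : ℕ) * α n) := by
          rw [← Real.exp_add]
          refine Real.exp_le_exp.2 ?_
          have := mul_le_mul_of_nonneg_left (hM n) (by positivity : (0 : ℝ) ≤ 2 * (k : ℕ))
          linarith
        have := mul_le_mul_of_nonneg_left he (by positivity : (0 : ℝ) ≤ 2 * (s ^ 2 * ‖x n‖ ^ 2))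
        simp only [b, a, PowerSeriesSpace.term, norm_mul, Complex.norm_real, mul_pow,
          Real.norm_eq_abs, sq_abs, Nat.add_one_ne_zero, if_false, Nat.add_sub_cancel]
        linarith
    · simp only [a, PowerSeriesSpace.term, norm_mul, Complex.norm_real, mul_pow,
        Real.norm_eq_abs, sq_abs]
      ring
  have hsum := (hb.mul_left (2 * s ^ 2 * E)).add (hx.hasSum.mul_left (2 * r ^ 2))
  have hS := Summable.of_nonneg_of_le (PowerSeriesSpace.term_nonneg α k _) hle hsum.summable
  refine ⟨hS, (hS.tsum_le_tsum hle hsum.summable).trans (le_of_eq ?_)⟩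
  rw [hsum.tsum_eq]; ring

/-- `B(r,s)` as an element of `ℒ(Λ_∞(α))`, defined whenever the differences `α_{n+1} - α_n` are
bounded above. -/
def genDiff (α : ℕ → ℝ) (hα : BddAbove (Set.range fun n => α (n + 1) - α n)) (r s : ℝ) :
    PowerSeriesSpace α →L[ℂ] PowerSeriesSpace α where
  toLinearMap := LinearMap.restrict (p := powerSeriesSubmodule α) (q := powerSeriesSubmodule α)
    (genDiffSeq r s) (fun x hx k => by
      obtain ⟨M, hM⟩ := hα
      exact (genDiffSeq_summable_and_tsum_le (fun n => hM ⟨n, rfl⟩) r s k x (hx k)).1)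
  cont := by
    refine WithSeminorms.continuous_of_isBounded (PowerSeriesSpace.withSeminorms α)
      (PowerSeriesSpace.withSeminorms α) _ (Seminorm.IsBounded.of_real fun k => ?_)
    obtain ⟨M, hM⟩ := hα
    refine ⟨{k}, √(2 * s ^ 2 * Real.exp (2 * (k : ℕ) * M) + 2 * r ^ 2), fun x => ?_⟩
    have h := (genDiffSeq_summable_and_tsum_le (fun n => hM ⟨n, rfl⟩) r s k
      (PowerSeriesSpace.toSeq α x) (PowerSeriesSpace.summable_term k x)).2
    have h' := Real.sqrt_le_sqrt h
    rw [Real.sqrt_mul (by positivity)] at h'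
    rw [Finset.sup_singleton]
    exact h'

/-- `genDiff` acts on the underlying sequences as the matrix `B(r,s)`. -/
theorem toSeq_genDiff (α : ℕ → ℝ) (hα : BddAbove (Set.range fun n => α (n + 1) - α n)) (r s : ℝ)
    (x : PowerSeriesSpace α) :
    PowerSeriesSpace.toSeq α (genDiff α hα r s x) = genDiffSeq r s (PowerSeriesSpace.toSeq α x) :=
  rfl

end

open Filter Topology

noncomputable section

/-! ### Seminorm estimates and functionals on `PowerSeriesSpace α` -/

namespace PowerSeriesSpace

variable {α : ℕ → ℝ}

/-! Two tools carry everything. The logarithmic lower bound on `α` gives some `m` with `∑ exp (-m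
α_n) < ∞`, so the ℓ²-seminorms may be traded for weighted sup-norms at the cost of passing from `k`
to `k + m`. It also makes `φ_z(x) = ∑ zⁿ xₙ` continuous for `|z| ≤ 1`, and `φ_z ∘ B = (r + s z)
φ_z`.

Upper bounds: since the increments of `α` tend to `0`, each weight `l α` is equivalent to a weight
with increments at most `δ`. In the corresponding sup-norm `B` has norm at most `|r| + |s| e^δ`,
which is below `1` for small `δ` once `|r| + |s| < 1`. Hence the powers decay geometrically
(`seminorm_genDiff_pow_le`).

Lower bounds: some `z = ±1` has `|r + s z| = |r| + |s|`, so `φ_z` detects growth along the orbit of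
the unit vector `e_0`. A bounded orbit of `e_0` forces `|r| + |s| < 1`
(`abs_add_abs_lt_one_of_bounded_orbit`), so the second and third implications of (b) both return to
this inequality and use geometric decay. The same functional gives `|r| + |s| ≤ 1` in (a), and
comparing it with `φ_0` excludes supercyclicity.

Mean ergodicity forces `|s| < |1 - r|`: otherwise `z = (1 - r)/s` gives a `B`-invariant functional
equal to `1` at `e_0`, while the limit of the Cesàro means is fixed by `B`, hence zero. Under that
inequality the formal inverse of `I - B` is bounded, by the same slow-weight argument. -/

open Real in
theorem exists_summable_exp_neg (hlog : ∃ c : ℝ, 0 < c ∧ ∀ n : ℕ, c * log ((n : ℝ) + 1) ≤ α n) :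
    ∃ m : ℕ+, Summable fun n => exp (-((m : ℕ) * α n)) := by
  obtain ⟨c, hc, h⟩ := hlog
  -- With `m c > 1` the terms are dominated by the convergent series of `(n + 1) ^ (-m c)`.
  obtain ⟨m, hm⟩ := exists_nat_gt (1 / c)
  have hm0 : 0 < m := by
    have : (0 : ℝ) < m := lt_trans (by positivity) hm
    exact_mod_cast this
  have hmc : 1 < m * c := by rwa [div_lt_iff₀ hc] at hm
  refine ⟨⟨m, hm0⟩, ?_⟩
  have hs : Summable fun n : ℕ => ((n + 1 : ℕ) : ℝ) ^ (-(m * c)) :=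
    (summable_nat_add_iff 1).2 (Real.summable_nat_rpow.2 (by linarith))
  refine Summable.of_nonneg_of_le (fun n => (exp_pos _).le) (fun n => ?_) hs
  rw [Real.rpow_def_of_pos (by positivity)]
  refine exp_le_exp.2 ?_
  have := mul_le_mul_of_nonneg_left (h n) (Nat.cast_nonneg' m : (0 : ℝ) ≤ m)
  push_cast
  simp only [PNat.mk_coe]
  linarith

theorem norm_toSeq_le (k : ℕ+) (x : PowerSeriesSpace α) (n : ℕ) :
    ‖toSeq α x n‖ ≤ seminorm α k x * Real.exp (-((k : ℕ) * α n)) := by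
  rw [Real.exp_neg, ← div_eq_mul_inv, le_div_iff₀ (Real.exp_pos _)]
  refine Real.le_sqrt_of_sq_le ?_
  have h := (summable_term k x).le_tsum n (fun j _ => term_nonneg α k _ j)
  refine le_trans (le_of_eq ?_) h
  rw [mul_pow, ← Real.exp_nat_mul, term]
  congr 2
  push_cast; ring

/-- The converse of `norm_toSeq_le`: the spare decay `exp (-2 m α_n) ≤ exp (-m α_n)` pays for the
summation, so a weighted sup bound at level `k + m` controls the ℓ²-norm at level `k`. -/
theorem summable_and_sqrt_tsum_term_le (hα : ∀ n, 0 ≤ α n) {m : ℕ+}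
    (hm : Summable fun n => Real.exp (-((m : ℕ) * α n))) (k : ℕ+) (x : ℕ → ℂ) {M : ℝ}
    (hM : 0 ≤ M) (hx : ∀ n, ‖x n‖ ≤ M * Real.exp (-(((k + m : ℕ+) : ℕ) * α n))) :
    Summable (term α k x) ∧
      √(∑' n, term α k x n) ≤ √(∑' n, Real.exp (-((m : ℕ) * α n))) * M := by
  have hle : ∀ n, term α k x n ≤ M ^ 2 * Real.exp (-((m : ℕ) * α n)) := fun n => by
    have h1 : ‖x n‖ ^ 2 ≤ M ^ 2 * Real.exp (2 * -(((k + m : ℕ+) : ℕ) * α n)) := by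
      have := pow_le_pow_left₀ (norm_nonneg _) (hx n) 2
      rwa [mul_pow, ← Real.exp_nat_mul] at this
    have h2 := mul_le_mul_of_nonneg_right h1 (Real.exp_pos (2 * (k : ℕ) * α n)).le
    refine h2.trans ?_
    rw [mul_assoc, ← Real.exp_add]
    refine mul_le_mul_of_nonneg_left (Real.exp_le_exp.2 ?_) (sq_nonneg M)
    have : 0 ≤ (m : ℕ) * α n := mul_nonneg (Nat.cast_nonneg _) (hα n)
    push_cast
    nlinarith
  have hs := Summable.of_nonneg_of_le (term_nonneg α k x) hle (hm.mul_left _)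
  refine ⟨hs, ?_⟩
  refine (Real.sqrt_le_sqrt (hs.tsum_le_tsum hle (hm.mul_left _))).trans (le_of_eq ?_)
  rw [tsum_mul_left, Real.sqrt_mul (sq_nonneg M), Real.sqrt_sq hM, mul_comm]

/-- A sequence dominating `α` up to a bounded error, all of whose increments are at most `ε`. -/
theorem exists_slow_majorant (hmono : Monotone α)
    (hdiff : Tendsto (fun n => α (n + 1) - α n) atTop (𝓝 0)) {ε : ℝ} (hε : 0 < ε) :
    ∃ (β : ℕ → ℝ) (C : ℝ), (∀ n, β (n + 1) ≤ β n + ε) ∧ (∀ n, α n ≤ β n) ∧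
      ∀ n, β n ≤ α n + C := by
  obtain ⟨N, hN⟩ := eventually_atTop.1 (hdiff.eventually (gt_mem_nhds hε))
  -- Freezing `α` at its value `α N` up to index `N` removes the finitely many possibly large
  -- increments.
  refine ⟨fun n => α (max n N), α N - α 0, fun n => ?_, fun n => hmono (le_max_left _ _),
    fun n => ?_⟩
  · rcases le_or_gt N n with h | h
    · have := hN n h
      simp only [max_eq_left h, max_eq_left (h.trans n.le_succ)]
      linarith
    · simp only [max_eq_right h.le, max_eq_right (Nat.succ_le_of_lt h)]
      linarith
  · have h0 := hmono (Nat.zero_le n)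
    rcases le_total N n with h | h
    · have := hmono (Nat.zero_le N)
      simp only [max_eq_left h]; linarith
    · simp only [max_eq_right h]; linarith

/-- The functional `x ↦ ∑ zⁿ xₙ`, for `|z| ≤ 1`. -/
theorem exists_powerFunctional {m : ℕ+} (hm : Summable fun n => Real.exp (-((m : ℕ) * α n)))
    {z : ℂ} (hz : ‖z‖ ≤ 1) :
    ∃ φ : PowerSeriesSpace α →L[ℂ] ℂ, ∀ x, HasSum (fun n => z ^ n * toSeq α x n) (φ x) := by
  have hle : ∀ x n, ‖z ^ n * toSeq α x n‖ ≤
      seminorm α m x * Real.exp (-((m : ℕ) * α n)) := fun x n => by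
    rw [norm_mul, norm_pow]
    exact (mul_le_of_le_one_left (norm_nonneg _) (pow_le_one₀ (norm_nonneg _) hz)).trans
      (norm_toSeq_le m x n)
  have hs : ∀ x, Summable fun n => z ^ n * toSeq α x n := fun x =>
    Summable.of_norm_bounded (hm.mul_left _) (hle x)
  let φ : PowerSeriesSpace α →ₗ[ℂ] ℂ :=
    { toFun := fun x => ∑' n, z ^ n * toSeq α x n
      map_add' := fun x y => by
        rw [← (hs x).tsum_add (hs y)]
        simp [mul_add]
      map_smul' := fun c x => by
        rw [RingHom.id_apply, smul_eq_mul, ← tsum_mul_left]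
        simp [mul_left_comm] }
  refine ⟨⟨φ, ?_⟩, fun x => (hs x).hasSum⟩
  refine WithSeminorms.continuous_of_isBounded (withSeminorms α) (norm_withSeminorms ℂ ℂ) φ
    (Seminorm.IsBounded.of_real fun _ => ⟨{m}, ∑' n, Real.exp (-((m : ℕ) * α n)), fun x => ?_⟩)
  rw [Finset.sup_singleton, mul_comm]
  have := tsum_of_norm_bounded (hm.mul_left (seminorm α m x)).hasSum (hle x)
  rwa [tsum_mul_left] at this

/-- Operators whose norms tend to `0` with respect to the defining seminorms tend to `0` uniformly
on bounded sets. -/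
theorem tendsto_zero_of_seminorm_le (T : ℕ → PowerSeriesSpace α →L[ℂ] PowerSeriesSpace α)
    (h : ∀ k : ℕ+, ∃ (l : ℕ+) (a : ℕ → ℝ), Tendsto a atTop (𝓝 0) ∧
      ∀ n x, seminorm α k (T n x) ≤ a n * seminorm α l x) :
    Tendsto T atTop (𝓝 0) := by
  refine ContinuousLinearMap.hasBasis_nhds_zero.tendsto_right_iff.2 ?_
  rintro ⟨S, U⟩ ⟨hS, hU⟩
  obtain ⟨s, ρ, hρ, hsub⟩ := ((withSeminorms α).mem_nhds_iff 0 U).1 hU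
  have key : ∀ k ∈ s, ∀ᶠ n in atTop, ∀ x ∈ S, seminorm α k (T n x) < ρ := fun k _ => by
    obtain ⟨l, a, ha, hle⟩ := h k
    obtain ⟨R, hR, hSR⟩ := ((withSeminorms α).isVonNBounded_iff_seminorm_bounded.1 hS) l
    filter_upwards [ha.abs.eventually_lt_const (u := ρ / R) (by simpa using div_pos hρ hR)]
      with n h2 x hx
    calc seminorm α k (T n x) ≤ a n * seminorm α l x := hle n x
      _ ≤ |a n| * seminorm α l x := mul_le_mul_of_nonneg_right (le_abs_self _) (apply_nonneg _ _)
      _ ≤ |a n| * R := mul_le_mul_of_nonneg_left (hSR x hx).le (abs_nonneg _)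
      _ < ρ := by rwa [lt_div_iff₀ hR] at h2
  filter_upwards [(Filter.eventually_all_finset s).2 key] with n hn x hx
  refine hsub ?_
  rw [Seminorm.mem_ball, sub_zero]
  exact Seminorm.finset_sup_apply_lt hρ fun k hk => hn k hk x hx

theorem powerBounded_of_seminorm_le (T : PowerSeriesSpace α →L[ℂ] PowerSeriesSpace α)
    (h : ∀ k : ℕ+, ∃ (l : ℕ+) (C : ℝ), ∀ n x, seminorm α k ((T ^ n) x) ≤ C * seminorm α l x) :
    ErgodicOp.PowerBounded T := by
  intro U hU
  obtain ⟨s, ρ, hρ, hsub⟩ := ((withSeminorms α).mem_nhds_iff 0 U).1 hU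
  choose l C hle using h
  refine ⟨⋂ k ∈ s, {x | |C k| * seminorm α (l k) x < ρ}, ?_, fun n x hx => hsub ?_⟩
  · refine (Filter.biInter_finset_mem s).2 fun k _ => ?_
    have hc : Continuous fun x => |C k| * seminorm α (l k) x :=
      continuous_const.mul ((withSeminorms α).continuous_seminorm (l k))
    exact hc.continuousAt.eventually (gt_mem_nhds (by simpa using hρ))
  · rw [Seminorm.mem_ball, sub_zero]
    refine Seminorm.finset_sup_apply_lt hρ fun k hk => (hle k n x).trans_lt ?_
    exact (mul_le_mul_of_nonneg_right (le_abs_self _) (apply_nonneg _ _)).trans_lt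
      (Set.mem_iInter₂.1 hx k hk)

/-- If all orbits are uniformly small on a neighbourhood of `0`, each single orbit is bounded. -/
theorem exists_seminorm_pow_le_of_powerBounded {T : PowerSeriesSpace α →L[ℂ] PowerSeriesSpace α}
    (hT : ErgodicOp.PowerBounded T) (k : ℕ+) (x : PowerSeriesSpace α) :
    ∃ M, ∀ n, seminorm α k ((T ^ n) x) ≤ M := by
  have hU : {y | seminorm α k y < 1} ∈ 𝓝 (0 : PowerSeriesSpace α) :=
    ((withSeminorms α).continuous_seminorm k).continuousAt.eventually
      (gt_mem_nhds (by simp [seminorms]))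
  obtain ⟨V, hV, h⟩ := hT _ hU
  -- `V` is absorbing; a small multiple of `x` lies in it, and homogeneity turns the bound `1` into
  -- `t⁻¹`.
  obtain ⟨t, ht, htx⟩ : ∃ t : ℝ, 0 < t ∧ (t : ℂ) • x ∈ V := by
    have hc : Tendsto (fun t : ℝ => (t : ℂ) • x) (𝓝[>] 0) (𝓝 0) := by
      have : Continuous fun t : ℝ => (t : ℂ) • x := by fun_prop
      simpa using (this.tendsto 0).mono_left nhdsWithin_le_nhds
    exact ((eventually_mem_nhdsWithin.and (hc.eventually hV))).exists
  refine ⟨t⁻¹, fun n => ?_⟩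
  have := h n htx
  rw [map_smul, Set.mem_ofPred_eq, map_smul_eq_mul, Complex.norm_real, Real.norm_of_nonneg ht.le]
    at this
  rw [← one_div, le_div_iff₀ ht, mul_comm]
  exact this.le

end PowerSeriesSpace

/-! ### Unit vectors, slow weights and coordinate estimates for `B` -/

namespace PowerSeriesSpace

variable {α : ℕ → ℝ}

theorem toSeq_injective : Function.Injective (toSeq α) := Subtype.val_injective

/-- The unit vector `e_i` of `Λ_∞(α)`. -/
def unitVec (α : ℕ → ℝ) (i : ℕ) : PowerSeriesSpace α :=
  ⟨Pi.single i 1, fun k => summable_of_ne_finset_zero (s := {i}) fun n hn => by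
    simp [term, Pi.single_eq_of_ne (Finset.notMem_singleton.1 hn)]⟩

theorem toSeq_unitVec (i : ℕ) : toSeq α (unitVec α i) = Pi.single i 1 := rfl

end PowerSeriesSpace

open PowerSeriesSpace

theorem genDiffSeq_zero (r s : ℝ) (x : ℕ → ℂ) : genDiffSeq r s x 0 = r * x 0 := by
  simp [genDiffSeq]

theorem genDiffSeq_succ (r s : ℝ) (x : ℕ → ℂ) (n : ℕ) :
    genDiffSeq r s x (n + 1) = s * x n + r * x (n + 1) := by
  simp [genDiffSeq]

/-- In the sup-norm with weight `exp γ`, a shift by one place costs at most the factor `exp δ`. -/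
theorem norm_genDiffSeq_le {γ : ℕ → ℝ} {δ : ℝ} (hγ : ∀ n, γ (n + 1) ≤ γ n + δ) (r s : ℝ)
    {x : ℕ → ℂ} {M : ℝ} (hM : 0 ≤ M) (hx : ∀ n, ‖x n‖ ≤ M * Real.exp (-γ n)) (n : ℕ) :
    ‖genDiffSeq r s x n‖ ≤ (|r| + |s| * Real.exp δ) * M * Real.exp (-γ n) := by
  have h1 : ∀ n, ‖(r : ℂ) * x n‖ ≤ |r| * (M * Real.exp (-γ n)) := fun n => by
    rw [norm_mul, Complex.norm_real, Real.norm_eq_abs]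
    exact mul_le_mul_of_nonneg_left (hx n) (abs_nonneg r)
  rcases n with _ | n
  · rw [genDiffSeq_zero]
    have : 0 ≤ |s| * Real.exp δ * (M * Real.exp (-γ 0)) := by positivity
    linarith [h1 0]
  · rw [genDiffSeq_succ]
    refine (norm_add_le _ _).trans ?_
    have h2 : ‖(s : ℂ) * x n‖ ≤ |s| * (M * (Real.exp δ * Real.exp (-γ (n + 1)))) := by
      rw [norm_mul, Complex.norm_real, Real.norm_eq_abs]
      refine mul_le_mul_of_nonneg_left ((hx n).trans ?_) (abs_nonneg s)
      refine mul_le_mul_of_nonneg_left ?_ hM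
      rw [← Real.exp_add]
      exact Real.exp_le_exp.2 (by linarith [hγ n])
    linarith [h1 (n + 1)]

theorem exists_pos_add_mul_exp_lt {a b t : ℝ} (h : a + b < t) :
    ∃ δ : ℝ, 0 < δ ∧ a + b * Real.exp δ < t := by
  have hc : Continuous fun δ : ℝ => a + b * Real.exp δ := by fun_prop
  have h0 : Tendsto (fun δ : ℝ => a + b * Real.exp δ) (𝓝[>] 0) (𝓝 (a + b)) := by
    simpa using (hc.tendsto 0).mono_left nhdsWithin_le_nhds
  exact (eventually_mem_nhdsWithin.and (h0.eventually (gt_mem_nhds h))).exists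

theorem exists_slow_weight {α : ℕ → ℝ} (hmono : Monotone α)
    (hdiff : Tendsto (fun n => α (n + 1) - α n) atTop (𝓝 0)) (l : ℕ+) {δ : ℝ} (hδ : 0 < δ) :
    ∃ (γ : ℕ → ℝ) (C : ℝ), (∀ n, γ (n + 1) ≤ γ n + δ) ∧ (∀ n, (l : ℕ) * α n ≤ γ n) ∧
      ∀ n, γ n ≤ (l : ℕ) * α n + C := by
  have hl : (0 : ℝ) < (l : ℕ) := by exact_mod_cast l.pos
  obtain ⟨β, C, h1, h2, h3⟩ := exists_slow_majorant hmono hdiff (div_pos hδ hl)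
  refine ⟨fun n => (l : ℕ) * β n, (l : ℕ) * C, fun n => ?_, fun n => ?_, fun n => ?_⟩
  · have := mul_le_mul_of_nonneg_left (h1 n) hl.le
    rwa [mul_add, mul_div_cancel₀ _ hl.ne'] at this
  · exact mul_le_mul_of_nonneg_left (h2 n) hl.le
  · have := mul_le_mul_of_nonneg_left (h3 n) hl.le
    rwa [mul_add] at this

/-! ### Powers of `B`, eigenfunctionals and supercyclicity -/

section

variable {α : ℕ → ℝ} (hbdd : BddAbove (Set.range fun n => α (n + 1) - α n)) (r s : ℝ)

theorem genDiff_apply_zero (x : PowerSeriesSpace α) :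
    toSeq α (genDiff α hbdd r s x) 0 = r * toSeq α x 0 := genDiffSeq_zero r s _

theorem genDiff_apply_succ (x : PowerSeriesSpace α) (n : ℕ) :
    toSeq α (genDiff α hbdd r s x) (n + 1) = s * toSeq α x n + r * toSeq α x (n + 1) :=
  genDiffSeq_succ r s _ n

theorem genDiff_pow_succ_apply (n : ℕ) (x : PowerSeriesSpace α) :
    (genDiff α hbdd r s ^ (n + 1)) x = genDiff α hbdd r s ((genDiff α hbdd r s ^ n) x) := by
  rw [pow_succ', mul_apply_eq_comp]

variable {r s}

theorem seminorm_genDiff_pow_le (hα : ∀ n, 0 ≤ α n) (hmono : Monotone α)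
    (hdiff : Tendsto (fun n => α (n + 1) - α n) atTop (𝓝 0)) {m : ℕ+}
    (hm : Summable fun n => Real.exp (-((m : ℕ) * α n))) (hrs : |r| + |s| < 1) (k : ℕ+) :
    ∃ (l : ℕ+) (C ρ : ℝ), 0 ≤ C ∧ 0 ≤ ρ ∧ ρ < 1 ∧
      ∀ n x, seminorm α k ((genDiff α hbdd r s ^ n) x) ≤ C * ρ ^ n * seminorm α l x := by
  obtain ⟨δ, hδ, hρ⟩ := exists_pos_add_mul_exp_lt hrs
  obtain ⟨γ, C, h1, h2, h3⟩ := exists_slow_weight hmono hdiff (k + m) hδ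
  set ρ := |r| + |s| * Real.exp δ
  have hρ0 : 0 ≤ ρ := by positivity
  refine ⟨k + m, √(∑' n, Real.exp (-((m : ℕ) * α n))) * Real.exp C, ρ, by positivity, hρ0, hρ,
    fun n x => ?_⟩
  -- The iteration runs entirely in the weight `γ`, so the comparison constant `exp C` between `γ`
  -- and `(k + m) α` enters once and not at every power.
  have hb : ∀ n j, ‖toSeq α ((genDiff α hbdd r s ^ n) x) j‖ ≤
      ρ ^ n * (seminorm α (k + m) x * Real.exp C) * Real.exp (-γ j) := by
    intro n
    induction n with
    | zero =>
      intro j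
      refine (norm_toSeq_le (k + m) x j).trans ?_
      rw [pow_zero, one_mul, mul_assoc, ← Real.exp_add]
      exact mul_le_mul_of_nonneg_left (Real.exp_le_exp.2 (by linarith [h3 j])) (apply_nonneg _ _)
    | succ n ih =>
      intro j
      rw [genDiff_pow_succ_apply, toSeq_genDiff, pow_succ', mul_assoc ρ]
      exact norm_genDiffSeq_le h1 r s
        (mul_nonneg (pow_nonneg hρ0 n) (mul_nonneg (apply_nonneg _ _) (Real.exp_pos _).le)) ih j
  have hnn : 0 ≤ ρ ^ n * (seminorm α (k + m) x * Real.exp C) :=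
    mul_nonneg (pow_nonneg hρ0 n) (mul_nonneg (apply_nonneg _ _) (Real.exp_pos _).le)
  refine (summable_and_sqrt_tsum_term_le hα hm k _ hnn fun j => (hb n j).trans
    (mul_le_mul_of_nonneg_left (Real.exp_le_exp.2 (neg_le_neg (h2 j))) hnn)).2.trans (le_of_eq ?_)
  ring

/-- On generating functions `∑ xₙ zⁿ`, the operator `B` is multiplication by `r + s z`. -/
theorem powerFunctional_genDiff {φ : PowerSeriesSpace α →L[ℂ] ℂ} {z : ℂ}
    (hφ : ∀ x, HasSum (fun n => z ^ n * toSeq α x n) (φ x)) (x : PowerSeriesSpace α) :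
    φ (genDiff α hbdd r s x) = (r + s * z) * φ x := by
  have h := (hasSum_nat_add_iff' 1).2 (hφ (genDiff α hbdd r s x))
  have h1 := (hasSum_nat_add_iff' 1).2 (hφ x)
  have h2 := ((hφ x).mul_left (s * z)).add (h1.mul_left (r : ℂ))
  have := h.unique (h2.congr_fun fun n => by rw [genDiff_apply_succ]; ring)
  simp only [Finset.sum_range_one, genDiff_apply_zero, pow_zero, one_mul] at this
  linear_combination this

theorem powerFunctional_genDiff_pow {φ : PowerSeriesSpace α →L[ℂ] ℂ} {z : ℂ}
    (hφ : ∀ x, HasSum (fun n => z ^ n * toSeq α x n) (φ x)) (n : ℕ) (x : PowerSeriesSpace α) :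
    φ ((genDiff α hbdd r s ^ n) x) = (r + s * z) ^ n * φ x := by
  induction n with
  | zero => simp
  | succ n ih => rw [genDiff_pow_succ_apply, powerFunctional_genDiff hbdd hφ, ih, pow_succ']; ring

theorem powerFunctional_unitVec {φ : PowerSeriesSpace α →L[ℂ] ℂ} {z : ℂ}
    (hφ : ∀ x, HasSum (fun n => z ^ n * toSeq α x n) (φ x)) (i : ℕ) :
    φ (unitVec α i) = z ^ i := by
  refine (hφ _).unique ?_
  rw [toSeq_unitVec]
  have := hasSum_single (f := fun n => z ^ n * (Pi.single i 1 : ℕ → ℂ) n) i fun n hn => by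
    simp [Pi.single_eq_of_ne hn]
  simpa using this

theorem genDiff_pow_unitVec_zero (n j : ℕ) :
    toSeq α ((genDiff α hbdd r s ^ n) (unitVec α 0)) j = n.choose j * r ^ (n - j) * s ^ j := by
  induction n generalizing j with
  | zero =>
    rcases j with _ | j <;> simp [toSeq_unitVec]
  | succ n ih =>
    rw [genDiff_pow_succ_apply]
    rcases j with _ | j
    · rw [genDiff_apply_zero, ih]; simp [pow_succ']
    · rw [genDiff_apply_succ, ih, ih, Nat.choose_succ_succ, Nat.succ_sub_succ]
      -- For `j ≥ n` the exponent `n - (j + 1)` is truncated, but its binomial coefficient vanishes.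
      rcases lt_or_ge j n with h | h
      · obtain ⟨d, rfl⟩ := Nat.exists_eq_add_of_lt h
        rw [show j + d + 1 - j = d + 1 by omega, show j + d + 1 - (j + 1) = d by omega]
        push_cast; ring
      · rw [Nat.choose_eq_zero_of_lt (Nat.lt_succ_of_le h)]
        push_cast; ring

/-- Take for `z` a sign that makes `r` and `s z` of equal sign. -/
theorem exists_norm_eq_one_norm_add_mul (r s : ℝ) :
    ∃ z : ℂ, ‖z‖ = 1 ∧ ‖(r : ℂ) + s * z‖ = |r| + |s| := by
  rcases le_total 0 (r * s) with h | h
  · refine ⟨1, by simp, ?_⟩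
    rw [mul_one, ← Complex.ofReal_add, Complex.norm_real, Real.norm_eq_abs]
    exact abs_add_eq_add_abs_iff _ _ |>.2 (mul_nonneg_iff.1 h)
  · refine ⟨-1, by simp, ?_⟩
    rw [mul_neg_one, ← Complex.ofReal_neg, ← Complex.ofReal_add, Complex.norm_real,
      Real.norm_eq_abs, ← abs_neg s]
    exact abs_add_eq_add_abs_iff _ _ |>.2 (mul_nonneg_iff.1 (by linarith))

theorem tendsto_choose_mul_pow_sub (hr : |r| < 1) (j : ℕ) :
    Tendsto (fun n : ℕ => (n.choose j : ℂ) * (r : ℂ) ^ (n - j)) atTop (𝓝 0) := by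
  refine (tendsto_add_atTop_iff_nat j).1 ?_
  have hr' : ‖(r : ℂ)‖ < 1 := by rwa [Complex.norm_real, Real.norm_eq_abs]
  simpa using (summable_choose_mul_geometric_of_norm_lt_one j hr').tendsto_atTop_zero

/-- If `|r| + |s| > 1`, the values `φ(Bⁿ e_0) = (r + s z)ⁿ` are unbounded. If `|r| + |s| = 1`, they
have modulus `1`; yet `|r| < 1` makes each coordinate of `Bⁿ e_0` tend to `0`, and boundedness of
the orbit supplies the summable majorant for dominated convergence, so they would tend to `0`. -/
theorem abs_add_abs_lt_one_of_bounded_orbit {m : ℕ+}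
    (hm : Summable fun n => Real.exp (-((m : ℕ) * α n))) (hs : s ≠ 0) {M : ℝ}
    (hM : ∀ n, seminorm α m ((genDiff α hbdd r s ^ n) (unitVec α 0)) ≤ M) :
    |r| + |s| < 1 := by
  obtain ⟨z, hz, hzrs⟩ := exists_norm_eq_one_norm_add_mul r s
  obtain ⟨φ, hφ⟩ := exists_powerFunctional hm hz.le
  have hφn : ∀ n, φ ((genDiff α hbdd r s ^ n) (unitVec α 0)) = (r + s * z) ^ n := fun n => by
    rw [powerFunctional_genDiff_pow hbdd hφ, powerFunctional_unitVec hφ, pow_zero, mul_one]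
  have hbound : ∀ n j, ‖z ^ j * toSeq α ((genDiff α hbdd r s ^ n) (unitVec α 0)) j‖ ≤
      M * Real.exp (-((m : ℕ) * α j)) := fun n j => by
    rw [norm_mul, norm_pow, hz, one_pow, one_mul]
    exact (norm_toSeq_le m _ j).trans (mul_le_mul_of_nonneg_right (hM n) (Real.exp_pos _).le)
  have hle : |r| + |s| ≤ 1 := by
    by_contra! h
    obtain ⟨n, hn⟩ := pow_unbounded_of_one_lt (M * ∑' j, Real.exp (-((m : ℕ) * α j))) h
    have := tsum_of_norm_bounded (hm.mul_left M).hasSum (hbound n)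
    rw [(hφ _).tsum_eq, hφn, norm_pow, hzrs, tsum_mul_left] at this
    linarith
  have hr : |r| < 1 := by linarith [abs_pos.2 hs]
  have hlim : Tendsto (fun n => φ ((genDiff α hbdd r s ^ n) (unitVec α 0))) atTop (𝓝 0) := by
    have := tendsto_tsum_of_dominated_convergence (𝓕 := atTop)
      (f := fun n j => z ^ j * toSeq α ((genDiff α hbdd r s ^ n) (unitVec α 0)) j)
      (g := fun _ => 0) (hm.mul_left M) (fun j => by
        simp only [genDiff_pow_unitVec_zero]
        simpa using ((tendsto_choose_mul_pow_sub hr j).mul_const ((s : ℂ) ^ j)).const_mul (z ^ j))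
      (Eventually.of_forall hbound)
    simpa only [(hφ _).tsum_eq, tsum_zero] using this
  refine hle.lt_of_ne fun heq => ?_
  have h1 := hlim.norm
  simp only [hφn, norm_pow, hzrs, heq, one_pow, norm_zero] at h1
  exact one_ne_zero (tendsto_nhds_unique tendsto_const_nhds h1)

theorem abs_add_abs_le_one_of_tendsto {m : ℕ+}
    (hm : Summable fun n => Real.exp (-((m : ℕ) * α n)))
    (h : Tendsto (fun n : ℕ => (n : ℂ)⁻¹ • (genDiff α hbdd r s ^ n) (unitVec α 0)) atTop (𝓝 0)) :
    |r| + |s| ≤ 1 := by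
  obtain ⟨z, hz, hzrs⟩ := exists_norm_eq_one_norm_add_mul r s
  obtain ⟨φ, hφ⟩ := exists_powerFunctional hm hz.le
  have h1 := (φ.continuous.tendsto _).comp h
  by_contra! hlt
  -- This is the reciprocal of `|φ(Bⁿ e_0 / n)|`: two null sequences would have a product eventually
  -- equal to `1`.
  have h2 : Tendsto (fun n : ℕ => (n : ℝ) ^ 1 / (|r| + |s|) ^ n) atTop (𝓝 0) :=
    tendsto_pow_const_div_const_pow_of_one_lt 1 hlt
  have h3 := h1.norm.mul h2
  simp only [map_zero, norm_zero, mul_zero] at h3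
  refine zero_ne_one (tendsto_nhds_unique h3 (tendsto_const_nhds.congr' ?_))
  filter_upwards [eventually_gt_atTop 0] with n hn
  have : (n : ℝ) ≠ 0 := by positivity
  have : (|r| + |s|) ^ n ≠ 0 := pow_ne_zero _ (by linarith)
  simp only [Function.comp_apply, map_smul, powerFunctional_genDiff_pow hbdd hφ,
    powerFunctional_unitVec hφ, pow_zero, mul_one, norm_smul, norm_inv, norm_pow, hzrs,
    Complex.norm_natCast, pow_one]
  field_simp

/-- The eigenvalue of `φ` has modulus `|r| + |s|`, at least the modulus `|r|` for `ψ`. So along a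
projective orbit `|ψ|` is controlled by `|φ|` in a closed, scaling-invariant inequality, which
density would extend to the whole space. -/
theorem not_supercyclic_genDiff {m : ℕ+} (hm : Summable fun n => Real.exp (-((m : ℕ) * α n))) :
    ¬ ErgodicOp.Supercyclic (genDiff α hbdd r s) := by
  rintro ⟨x, hx⟩
  obtain ⟨z, hz, hzrs⟩ := exists_norm_eq_one_norm_add_mul r s
  obtain ⟨φ, hφ⟩ := exists_powerFunctional hm hz.le
  obtain ⟨ψ, hψ⟩ := exists_powerFunctional (z := 0) hm (by simp)
  have hz0 : z ≠ 0 := by rintro rfl; simp at hz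
  have hcl : ∀ y, ‖ψ y‖ * ‖φ x‖ ≤ ‖φ y‖ * ‖ψ x‖ := fun y => by
    refine hx.induction (P := fun y => ‖ψ y‖ * ‖φ x‖ ≤ ‖φ y‖ * ‖ψ x‖) ?_
      (isClosed_le (by fun_prop) (by fun_prop)) y
    rintro _ ⟨n, c, rfl⟩
    simp only [map_smul, powerFunctional_genDiff_pow hbdd hφ, powerFunctional_genDiff_pow hbdd hψ,
      norm_smul, norm_mul, norm_pow, hzrs, mul_zero, add_zero, Complex.norm_real, Real.norm_eq_abs]
    have : |r| ^ n ≤ (|r| + |s|) ^ n :=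
      pow_le_pow_left₀ (abs_nonneg r) (by linarith [abs_nonneg s]) n
    have := mul_le_mul_of_nonneg_left this (by positivity : 0 ≤ ‖c‖ * ‖ψ x‖ * ‖φ x‖)
    linarith
  have hφx : φ x = 0 := by
    -- This vector lies in the kernel of `φ` and has `ψ`-value `1`.
    have := hcl (unitVec α 0 - z⁻¹ • unitVec α 1)
    simpa [powerFunctional_unitVec hφ, powerFunctional_unitVec hψ, hz0] using this
  have hφ0 : ∀ y, φ y = 0 := fun y => by
    refine hx.induction (P := fun y => φ y = 0) ?_ (isClosed_eq (by fun_prop) (by fun_prop)) y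
    rintro _ ⟨n, c, rfl⟩
    rw [map_smul, powerFunctional_genDiff_pow hbdd hφ, hφx, mul_zero, smul_zero]
  simpa [powerFunctional_unitVec hφ] using hφ0 (unitVec α 0)

end

/-! ### Cesàro means of a general operator -/

namespace ErgodicOp

variable {X : Type*} [AddCommGroup X] [Module ℂ X] [TopologicalSpace X]
  [IsTopologicalAddGroup X] [ContinuousSMul ℂ X]

theorem cesaroMean_apply (T : X →L[ℂ] X) (n : ℕ) (x : X) :
    cesaroMean T n x = (n : ℂ)⁻¹ • ∑ m ∈ Finset.Icc 1 n, (T ^ m) x := by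
  simp [cesaroMean]

theorem natCast_smul_cesaroMean_apply (T : X →L[ℂ] X) (n : ℕ) (x : X) :
    (n : ℂ) • cesaroMean T n x = ∑ m ∈ Finset.Icc 1 n, (T ^ m) x := by
  rcases eq_or_ne n 0 with rfl | hn
  · simp
  · rw [cesaroMean_apply, smul_inv_smul₀ (Nat.cast_ne_zero.2 hn)]

theorem MeanErgodic.tendstoStrong_inv_smul_pow {T : X →L[ℂ] X} (h : MeanErgodic T) :
    TendstoStrong (fun n : ℕ => (n : ℂ)⁻¹ • T ^ n) 0 := by
  obtain ⟨P, hP⟩ := h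
  intro x
  refine (tendsto_add_atTop_iff_nat 1).1 ?_
  -- `T^(n+1)/(n+1) = T_[n+1] - (n/(n+1)) T_[n]`, and both terms on the right have the limit `P`.
  have h1 := ((tendsto_add_atTop_iff_nat 1).2 (hP x)).sub
    ((tendsto_natCast_div_add_atTop (1 : ℂ)).smul (hP x))
  rw [one_smul, sub_self] at h1
  refine h1.congr fun n => ?_
  rw [div_eq_inv_mul, mul_smul, natCast_smul_cesaroMean_apply, cesaroMean_apply,
    Finset.sum_Icc_succ_top (by omega), smul_add]
  simp

/-- Telescoping: applying `T` to the sum only exchanges `T x` for `T^(n+1) x`. Both boundary terms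
vanish in the limit, so limits of Cesàro means are fixed points. -/
theorem apply_cesaroMean (T : X →L[ℂ] X) (n : ℕ) (x : X) :
    T (cesaroMean T n x) = cesaroMean T n x + T (((n : ℂ)⁻¹ • T ^ n) x) - (n : ℂ)⁻¹ • T x := by
  have h : ∀ n : ℕ, T (∑ m ∈ Finset.Icc 1 n, (T ^ m) x) + T x =
      (∑ m ∈ Finset.Icc 1 n, (T ^ m) x) + T ((T ^ n) x) := fun n => by
    induction n with
    | zero => simp
    | succ n ih =>
      rw [Finset.sum_Icc_succ_top (by omega), map_add, pow_succ', mul_apply_eq_comp,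
        add_right_comm, ih]
  have h' := congrArg (fun y => (n : ℂ)⁻¹ • y) (h n)
  simp only [smul_add] at h'
  rw [cesaroMean_apply, map_smul, smul_apply, map_smul, ← h', add_sub_cancel_right]

theorem apply_limit_of_tendstoStrong_cesaroMean [T2Space X] {T P : X →L[ℂ] X}
    (hP : TendstoStrong (cesaroMean T) P) (x : X) : T (P x) = P x := by
  have h1 := (T.continuous.tendsto _).comp (hP x)
  have h2 := (T.continuous.tendsto _).comp
    (MeanErgodic.tendstoStrong_inv_smul_pow ⟨P, hP⟩ x)
  have h3 : Tendsto (fun n : ℕ => (n : ℂ)⁻¹ • T x) atTop (𝓝 0) := by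
    simpa using (tendsto_inv_atTop_nhds_zero_nat (𝕜 := ℂ)).smul_const (T x)
  refine tendsto_nhds_unique h1 ((((hP x).add h2).sub h3).congr' ?_ |>.trans ?_)
  · exact Eventually.of_forall fun n => (apply_cesaroMean T n x).symm
  · simp

theorem functional_limit_of_tendstoStrong_cesaroMean {T P : X →L[ℂ] X}
    (hP : TendstoStrong (cesaroMean T) P) {φ : X →L[ℂ] ℂ} (hφ : ∀ x, φ (T x) = φ x) (x : X) :
    φ (P x) = φ x := by
  have hpow : ∀ m, φ ((T ^ m) x) = φ x := fun m => by
    induction m with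
    | zero => simp
    | succ m ih => rw [pow_succ', mul_apply_eq_comp, hφ, ih]
  refine tendsto_nhds_unique ((φ.continuous.tendsto _).comp (hP x))
    (tendsto_const_nhds.congr' ?_)
  filter_upwards [eventually_ne_atTop 0] with n hn
  have : (n : ℂ) ≠ 0 := Nat.cast_ne_zero.2 hn
  simp only [Function.comp_apply, cesaroMean_apply, map_smul, map_sum, hpow, Finset.sum_const,
    Nat.card_Icc, Nat.add_sub_cancel, nsmul_eq_mul, smul_eq_mul]
  rw [inv_mul_cancel_left₀ this]

theorem UniformlyMeanErgodic.meanErgodic {T : X →L[ℂ] X} (h : UniformlyMeanErgodic T) :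
    MeanErgodic T := by
  obtain ⟨P, hP⟩ := h
  exact ⟨P, fun x => ((continuous_eval_const x).tendsto P).comp hP⟩

end ErgodicOp

/-! ### Fixed points, mean ergodicity and the resolvent at `1` -/

open PowerSeriesSpace ErgodicOp

instance PowerSeriesSpace.instT2Space (α : ℕ → ℝ) : T2Space (PowerSeriesSpace α) := by
  have : T1Space (PowerSeriesSpace α) :=
    (withSeminorms α).T1_of_separating fun x hx => ⟨1, fun h0 => hx (toSeq_injective ?_)⟩
  · infer_instance
  · funext n
    have := norm_toSeq_le 1 x n
    rw [show seminorm α 1 x = 0 from h0, zero_mul] at this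
    simpa using this

section

variable {α : ℕ → ℝ} (hbdd : BddAbove (Set.range fun n => α (n + 1) - α n)) {r s : ℝ}

/-- The fixed-point equation reads `(1 - r) x_{n+1} = s x_n` with `(1 - r) x_0 = 0`. If `r = 1` it
gives `s x_n = 0` directly; otherwise zeros propagate upwards from `x_0`. -/
theorem eq_zero_of_genDiff_eq_self (hs : s ≠ 0) {x : PowerSeriesSpace α}
    (hx : genDiff α hbdd r s x = x) : x = 0 := by
  have h0 := genDiff_apply_zero hbdd r s x
  have h1 := genDiff_apply_succ hbdd r s x
  rw [hx] at h0 h1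
  have hs' : (s : ℂ) ≠ 0 := by exact_mod_cast hs
  refine toSeq_injective (funext fun n => ?_)
  rw [map_zero, Pi.zero_apply]
  rcases eq_or_ne (r : ℂ) 1 with hr | hr
  · have := h1 n
    rw [hr] at this
    exact (mul_eq_zero.1 (by linear_combination -this)).resolve_left hs'
  · have hr' : (1 : ℂ) - r ≠ 0 := sub_ne_zero.2 hr.symm
    induction n with
    | zero => exact (mul_eq_zero.1 (by linear_combination h0)).resolve_left hr'
    | succ n ih =>
      have := h1 n
      rw [ih] at this
      exact (mul_eq_zero.1 (by linear_combination this)).resolve_left hr'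

theorem abs_lt_abs_one_sub_of_meanErgodic {m : ℕ+}
    (hm : Summable fun n => Real.exp (-((m : ℕ) * α n))) (hs : s ≠ 0)
    (h : MeanErgodic (genDiff α hbdd r s)) : |s| < |1 - r| := by
  by_contra! hle
  obtain ⟨P, hP⟩ := h
  have hs' : (s : ℂ) ≠ 0 := by exact_mod_cast hs
  -- This `z` solves `r + s z = 1`, so `φ` is `B`-invariant and keeps its value `1` at `e_0` under
  -- the limit `P`, although `P e_0 = 0`.
  have hz : ‖(1 - r : ℂ) / s‖ ≤ 1 := by
    rw [← Complex.ofReal_one, ← Complex.ofReal_sub, ← Complex.ofReal_div, Complex.norm_real,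
      Real.norm_eq_abs, abs_div]
    exact div_le_one_of_le₀ hle (abs_nonneg s)
  obtain ⟨φ, hφ⟩ := exists_powerFunctional hm hz
  have hfix : ∀ x, φ (genDiff α hbdd r s x) = φ x := fun x => by
    rw [powerFunctional_genDiff hbdd hφ, mul_div_cancel₀ _ hs', add_sub_cancel, one_mul]
  have h1 := functional_limit_of_tendstoStrong_cesaroMean hP hfix (unitVec α 0)
  rw [eq_zero_of_genDiff_eq_self hbdd hs
    (apply_limit_of_tendstoStrong_cesaroMean hP (unitVec α 0)), map_zero,
    powerFunctional_unitVec hφ, pow_zero] at h1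
  exact zero_ne_one h1

theorem tendsto_cesaroMean_of_seminorm_pow_le {T : PowerSeriesSpace α →L[ℂ] PowerSeriesSpace α}
    (h : ∀ k : ℕ+, ∃ (l : ℕ+) (C ρ : ℝ), 0 ≤ C ∧ 0 ≤ ρ ∧ ρ < 1 ∧
      ∀ n x, seminorm α k ((T ^ n) x) ≤ C * ρ ^ n * seminorm α l x) :
    Tendsto (cesaroMean T) atTop (𝓝 0) := by
  refine tendsto_zero_of_seminorm_le _ fun k => ?_
  obtain ⟨l, C, ρ, hC, hρ0, hρ1, hle⟩ := h k
  refine ⟨l, fun n => (n : ℝ)⁻¹ * (C * (1 - ρ)⁻¹), ?_, fun n x => ?_⟩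
  · simpa using (tendsto_inv_atTop_nhds_zero_nat (𝕜 := ℝ)).mul_const (C * (1 - ρ)⁻¹)
  · have hgeom : ∑ m ∈ Finset.Icc 1 n, ρ ^ m ≤ (1 - ρ)⁻¹ := by
      rw [← tsum_geometric_of_lt_one hρ0 hρ1]
      exact (summable_geometric_of_lt_one hρ0 hρ1).sum_le_tsum _ fun i _ => pow_nonneg hρ0 i
    rw [cesaroMean_apply, map_smul_eq_mul, norm_inv, Complex.norm_natCast, mul_assoc]
    refine mul_le_mul_of_nonneg_left ?_ (by positivity)
    calc seminorm α k (∑ m ∈ Finset.Icc 1 n, (T ^ m) x)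
        ≤ ∑ m ∈ Finset.Icc 1 n, seminorm α k ((T ^ m) x) :=
          Finset.le_sum_of_subadditive _ (map_zero _).le (map_add_le_add _) _ _
      _ ≤ ∑ m ∈ Finset.Icc 1 n, C * ρ ^ m * seminorm α l x := Finset.sum_le_sum fun m _ => hle m x
      _ = C * (∑ m ∈ Finset.Icc 1 n, ρ ^ m) * seminorm α l x := by
          rw [← Finset.sum_mul, Finset.mul_sum]
      _ ≤ _ := mul_le_mul_of_nonneg_right (mul_le_mul_of_nonneg_left hgeom hC) (apply_nonneg _ _)

/-- The formal inverse of `I - B(r,s)` on the space of all sequences. -/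
def genDiffResolventSeq (r s : ℝ) : (ℕ → ℂ) →ₗ[ℂ] (ℕ → ℂ) where
  toFun y n := ∑ j ∈ Finset.range (n + 1), (s : ℂ) ^ j / (1 - r) ^ (j + 1) * y (n - j)
  map_add' x y := by
    funext n
    simp [mul_add, Finset.sum_add_distrib]
  map_smul' c x := by
    funext n
    simp [mul_left_comm _ c, Finset.mul_sum]

theorem genDiffResolventSeq_zero (r s : ℝ) (y : ℕ → ℂ) :
    genDiffResolventSeq r s y 0 = y 0 / (1 - r) := by
  simp [genDiffResolventSeq, div_eq_inv_mul]

theorem genDiffResolventSeq_succ (r s : ℝ) (y : ℕ → ℂ) (n : ℕ) :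
    genDiffResolventSeq r s y (n + 1) =
      (y (n + 1) + s * genDiffResolventSeq r s y n) / (1 - r) := by
  simp only [genDiffResolventSeq, LinearMap.coe_mk, AddHom.coe_mk]
  rw [Finset.sum_range_succ', add_comm, add_div, Finset.mul_sum, Finset.sum_div]
  congr 1
  · simp [div_eq_inv_mul]
  · refine Finset.sum_congr rfl fun j _ => ?_
    rw [Nat.add_sub_add_right, pow_succ' _ (j + 1), pow_succ' (s : ℂ), ← div_div]
    simp only [div_eq_mul_inv]
    ring

theorem genDiffSeq_genDiffResolventSeq (hr : r ≠ 1) (y : ℕ → ℂ) :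
    genDiffResolventSeq r s y - genDiffSeq r s (genDiffResolventSeq r s y) = y := by
  have hr' : (1 : ℂ) - r ≠ 0 := sub_ne_zero.2 (by exact_mod_cast hr.symm)
  funext n
  rcases n with _ | n
  · rw [Pi.sub_apply, genDiffSeq_zero, genDiffResolventSeq_zero]
    field_simp
  · rw [Pi.sub_apply, genDiffSeq_succ, genDiffResolventSeq_succ]
    field_simp
    ring

/-- The resolvent obeys a first-order recursion, and `D = (|1 - r| - |s| e^δ)⁻¹` is the constant it
reproduces: `D |1 - r| = 1 + D |s| e^δ`. -/
theorem norm_genDiffResolventSeq_le {γ : ℕ → ℝ} {δ : ℝ} (hγ : ∀ n, γ (n + 1) ≤ γ n + δ)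
    (hδ : |s| * Real.exp δ < |1 - r|) {y : ℕ → ℂ} {M : ℝ}
    (hM : 0 ≤ M) (hy : ∀ n, ‖y n‖ ≤ M * Real.exp (-γ n)) (n : ℕ) :
    ‖genDiffResolventSeq r s y n‖ ≤ (|1 - r| - |s| * Real.exp δ)⁻¹ * M * Real.exp (-γ n) := by
  set D := (|1 - r| - |s| * Real.exp δ)⁻¹ with hD
  have hpos : 0 < |1 - r| - |s| * Real.exp δ := sub_pos.2 hδ
  have hD0 : 0 < D := inv_pos.2 hpos
  have hDeq : D * |1 - r| = 1 + D * (|s| * Real.exp δ) := by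
    have := inv_mul_cancel₀ hpos.ne'
    rw [← hD, mul_sub] at this
    linarith
  have hr : 0 < |1 - r| := lt_of_le_of_lt (by positivity) hδ
  have hnorm : ‖(1 : ℂ) - r‖ = |1 - r| := by
    rw [← Complex.ofReal_one, ← Complex.ofReal_sub, Complex.norm_real, Real.norm_eq_abs]
  induction n with
  | zero =>
    rw [genDiffResolventSeq_zero, norm_div, hnorm, div_le_iff₀ hr]
    have h1 : D * M * Real.exp (-γ 0) * |1 - r| =
        (1 + D * (|s| * Real.exp δ)) * (M * Real.exp (-γ 0)) := by rw [← hDeq]; ring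
    have h2 : 0 ≤ D * (|s| * Real.exp δ) * (M * Real.exp (-γ 0)) := by positivity
    linarith [hy 0]
  | succ n ih =>
    rw [genDiffResolventSeq_succ, norm_div, hnorm, div_le_iff₀ hr]
    have h1 : D * M * Real.exp (-γ (n + 1)) * |1 - r| =
        (1 + D * (|s| * Real.exp δ)) * (M * Real.exp (-γ (n + 1))) := by rw [← hDeq]; ring
    have h2 : ‖(s : ℂ) * genDiffResolventSeq r s y n‖ ≤
        |s| * (D * M * (Real.exp δ * Real.exp (-γ (n + 1)))) := by
      rw [norm_mul, Complex.norm_real, Real.norm_eq_abs]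
      refine mul_le_mul_of_nonneg_left (ih.trans ?_) (abs_nonneg s)
      refine mul_le_mul_of_nonneg_left ?_ (by positivity)
      rw [← Real.exp_add]
      exact Real.exp_le_exp.2 (by linarith [hγ n])
    linarith [hy (n + 1), norm_add_le (y (n + 1)) ((s : ℂ) * genDiffResolventSeq r s y n)]

theorem exists_genDiffResolventSeq_bound (hα : ∀ n, 0 ≤ α n) (hmono : Monotone α)
    (hdiff : Tendsto (fun n => α (n + 1) - α n) atTop (𝓝 0)) {m : ℕ+}
    (hm : Summable fun n => Real.exp (-((m : ℕ) * α n))) (hrs : |s| < |1 - r|) (k : ℕ+) :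
    ∃ (l : ℕ+) (C : ℝ), ∀ x : PowerSeriesSpace α,
      Summable (term α k (genDiffResolventSeq r s (toSeq α x))) ∧
        √(∑' n, term α k (genDiffResolventSeq r s (toSeq α x)) n) ≤ C * seminorm α l x := by
  obtain ⟨δ, hδ, hlt⟩ := exists_pos_add_mul_exp_lt (a := 0) (by rwa [zero_add] : 0 + |s| < |1 - r|)
  rw [zero_add] at hlt
  obtain ⟨γ, C, h1, h2, h3⟩ := exists_slow_weight hmono hdiff (k + m) hδ
  refine ⟨k + m, √(∑' n, Real.exp (-((m : ℕ) * α n))) *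
    ((|1 - r| - |s| * Real.exp δ)⁻¹ * Real.exp C), fun x => ?_⟩
  have hnn : 0 ≤ seminorm α (k + m) x * Real.exp C :=
    mul_nonneg (apply_nonneg _ _) (Real.exp_pos _).le
  have hD : 0 ≤ (|1 - r| - |s| * Real.exp δ)⁻¹ := (inv_pos.2 (sub_pos.2 hlt)).le
  have hb := norm_genDiffResolventSeq_le h1 hlt hnn (y := toSeq α x) fun j => by
    refine (norm_toSeq_le (k + m) x j).trans ?_
    rw [mul_assoc, ← Real.exp_add]
    exact mul_le_mul_of_nonneg_left (Real.exp_le_exp.2 (by linarith [h3 j])) (apply_nonneg _ _)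
  have := summable_and_sqrt_tsum_term_le hα hm k _ (mul_nonneg hD hnn) fun j => (hb j).trans
    (mul_le_mul_of_nonneg_left (Real.exp_le_exp.2 (neg_le_neg (h2 j))) (mul_nonneg hD hnn))
  exact ⟨this.1, this.2.trans (le_of_eq (by ring))⟩

theorem one_notMem_spectrum_genDiff (hα : ∀ n, 0 ≤ α n) (hmono : Monotone α)
    (hdiff : Tendsto (fun n => α (n + 1) - α n) atTop (𝓝 0)) {m : ℕ+}
    (hm : Summable fun n => Real.exp (-((m : ℕ) * α n))) (hs : s ≠ 0) (hrs : |s| < |1 - r|) :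
    (1 : ℂ) ∉ spectrum ℂ (genDiff α hbdd r s) := by
  have hbound := exists_genDiffResolventSeq_bound hα hmono hdiff hm hrs
  have hr : r ≠ 1 := by
    rintro rfl
    rw [sub_self, abs_zero] at hrs
    exact absurd hrs (abs_nonneg s).not_gt
  let R₀ : PowerSeriesSpace α →ₗ[ℂ] PowerSeriesSpace α :=
    LinearMap.restrict (p := powerSeriesSubmodule α) (q := powerSeriesSubmodule α)
      (genDiffResolventSeq r s) fun x hx k => by
        obtain ⟨l, C, h⟩ := hbound k
        exact (h (⟨x, hx⟩ : powerSeriesSubmodule α)).1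
  let R : PowerSeriesSpace α →L[ℂ] PowerSeriesSpace α := ⟨R₀, by
    refine WithSeminorms.continuous_of_isBounded (withSeminorms α) (withSeminorms α) _
      (Seminorm.IsBounded.of_real fun k => ?_)
    obtain ⟨l, C, h⟩ := hbound k
    refine ⟨{l}, C, fun x => ?_⟩
    rw [Finset.sup_singleton]
    exact (h x).2⟩
  have hright : ∀ x, R x - genDiff α hbdd r s (R x) = x := fun x =>
    toSeq_injective (genDiffSeq_genDiffResolventSeq hr (toSeq α x))
  -- A right inverse of the injective operator `1 - B` is also a left inverse.
  have hleft : ∀ x, R (x - genDiff α hbdd r s x) = x := fun x => by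
    have h := hright (x - genDiff α hbdd r s x)
    refine sub_eq_zero.1 (eq_zero_of_genDiff_eq_self hbdd hs (r := r) ?_)
    rw [map_sub]
    set y := R (x - genDiff α hbdd r s x)
    calc genDiff α hbdd r s y - genDiff α hbdd r s x
        = y - (y - genDiff α hbdd r s y) - genDiff α hbdd r s x := by abel
      _ = y - x := by rw [h]; abel
  rw [spectrum.notMem_iff, map_one]
  exact ⟨⟨1 - genDiff α hbdd r s, R, ContinuousLinearMap.ext hright,
    ContinuousLinearMap.ext hleft⟩, rfl⟩

end

end

/-! ### Assembly of the implications -/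

open ErgodicOp in
theorem proposition4p11 (α : ℕ → ℝ) (hα_nonneg : ∀ n, 0 ≤ α n) (hα_mono : Monotone α)
    (hα_top : Tendsto α atTop atTop)
    (hα_diff : Tendsto (fun n => α (n + 1) - α n) atTop (𝓝 0))
    (hα_log : ∃ c : ℝ, 0 < c ∧ ∀ n : ℕ, c * Real.log ((n : ℝ) + 1) ≤ α n)
    (r s : ℝ) (hr : r ≠ 0) (hs : s ≠ 0)
    (B : PowerSeriesSpace α →L[ℂ] PowerSeriesSpace α)
    (hB : B = genDiff α hα_diff.bddAbove_range r s) :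
    ((MeanErgodic B → TendstoStrong (fun n : ℕ => (n : ℂ)⁻¹ • B ^ n) 0) ∧
      (TendstoStrong (fun n : ℕ => (n : ℂ)⁻¹ • B ^ n) 0 → |r| + |s| ≤ 1)) ∧
    ((|r| + |s| < 1 → TendstoUniform (fun n : ℕ => B ^ n) 0) ∧
      (TendstoUniform (fun n : ℕ => B ^ n) 0 → PowerBounded B) ∧
      (PowerBounded B → UniformlyMeanErgodic B) ∧
      (UniformlyMeanErgodic B → (1 : ℂ) ∉ spectrum ℂ B)) ∧
    ¬ Supercyclic B := by
  obtain ⟨m, hm⟩ := PowerSeriesSpace.exists_summable_exp_neg hα_log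
  have hgeom := fun h : |r| + |s| < 1 =>
    seminorm_genDiff_pow_le hα_diff.bddAbove_range hα_nonneg hα_mono hα_diff hm h
  subst hB
  refine ⟨⟨MeanErgodic.tendstoStrong_inv_smul_pow, fun h =>
    abs_add_abs_le_one_of_tendsto _ hm (h _)⟩, ⟨fun h => ?_, fun h => ?_, fun h => ?_, fun h => ?_⟩,
    not_supercyclic_genDiff _ hm⟩
  · refine PowerSeriesSpace.tendsto_zero_of_seminorm_le _ fun k => ?_
    obtain ⟨l, C, ρ, -, h0, h1, hle⟩ := hgeom h k
    exact ⟨l, fun n => C * ρ ^ n, by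
      simpa using (tendsto_pow_atTop_nhds_zero_of_lt_one h0 h1).const_mul C, hle⟩
  -- Evaluation at `e_0` gives a convergent, hence bounded, sequence of `m`-seminorms; this already
  -- yields `|r| + |s| < 1`.
  · have horbit := (((PowerSeriesSpace.withSeminorms α).continuous_seminorm m).comp
      (continuous_eval_const (PowerSeriesSpace.unitVec α 0))).tendsto 0 |>.comp h
    obtain ⟨M, hM⟩ := horbit.bddAbove_range
    have hlt := abs_add_abs_lt_one_of_bounded_orbit _ hm hs fun n => hM ⟨n, rfl⟩
    refine PowerSeriesSpace.powerBounded_of_seminorm_le _ fun k => ?_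
    obtain ⟨l, C, ρ, hC, h0, h1, hle⟩ := hgeom hlt k
    exact ⟨l, C, fun n x => (hle n x).trans (mul_le_mul_of_nonneg_right
      (mul_le_of_le_one_right hC (pow_le_one₀ h0 h1.le)) (apply_nonneg _ _))⟩
  · obtain ⟨M, hM⟩ := PowerSeriesSpace.exists_seminorm_pow_le_of_powerBounded h m
      (PowerSeriesSpace.unitVec α 0)
    exact ⟨0, tendsto_cesaroMean_of_seminorm_pow_le
      (hgeom (abs_add_abs_lt_one_of_bounded_orbit _ hm hs hM))⟩
  · exact one_notMem_spectrum_genDiff _ hα_nonneg hα_mono hα_diff hm hs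
      (abs_lt_abs_one_sub_of_meanErgodic _ hm hs h.meanErgodic)
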